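/- Let $k$ be an algebraically closed field, and call a reduced separated scheme of finite type over $k$ a variety (it may be reducible, disconnected or empty). Let $K_0(k)$ be the Grothendieck ring of varieties: the commutative ring generated by the isomorphism classes $[Y]$ of varieties $Y$ over $k$, subject to the relations $[Y]=[Z]+[Y\setminus Z]$ for every closed subvariety $Z\subseteq Y$, $[Y]\cdot[Y']=[Y\times_k Y']$, and $[\operatorname{Spec} k]=1$. Let $G$ be a finite group acting on a variety $X$ by automorphisms over $k$, and let $S=\bigcup_{g\in G\setminus\{e\}}X^g$ be the set of (closed) points of $X$ that are fixed by some nontrivial element of $G$. Assume that $S$ is finite and $S\neq\emptyset$. For $n\ge 0$ let $$\operatorname{Conf}_n^G(X\setminus S)=\{(x_1,\dots,x_n)\in (X\setminus S)^n \mid Gx_i\cap Gx_j=\emptyset \text{ for } i\neq j\},$$ that is, the open subvariety of $X^n$ that is the complement of the closed subsets $\{g\cdot x_i=x_j\}$ ($1\le i<j\le n$, $g\in G$) and $\{x_i=s\}$ ($1\le i\le n$, $s\in S$). Then in $K_0(k)$ $$[\operatorname{Conf}_n^G(X\setminus S)]=\prod_{i=0}^{n-1}\bigl([X]-|S|-|G|\,i\bigr).$$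 -/

import Mathlib

open CategoryTheory Limits AlgebraicGeometry
open scoped TensorProduct

universe u

namespace OrbitConf

theorem isReduced_tensor_aux (k A B : Type u) [Field k] [IsAlgClosed k] [CommRing A] [Algebra k A]
    [CommRing B] [Algebra k B] [Algebra.FiniteType k A] [_root_.IsReduced A] [_root_.IsReduced B] :
    _root_.IsReduced (A ⊗[k] B) := by
  constructor
  intro z hz
  let b := Module.Free.chooseBasis k B
  have : IsJacobsonRing A := isJacobsonRing_of_finiteType (A := k)
  have key (φ : A →ₐ[k] k) (w : A ⊗[k] B) (i) :
      b.repr ((Algebra.TensorProduct.lid k B) (Algebra.TensorProduct.map φ (AlgHom.id k B) w)) i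
        = φ ((Algebra.TensorProduct.basis A b).repr w i) := by
    induction w with
    | zero => simp
    | add x y hx hy => simp only [map_add, Finsupp.add_apply, hx, hy]
    | tmul x y => simp [Algebra.TensorProduct.basis_repr_tmul]
  apply (Algebra.TensorProduct.basis A b).repr.injective
  ext i
  rw [map_zero, Finsupp.zero_apply]
  set c := (Algebra.TensorProduct.basis A b).repr z i with hc
  have hmem : c ∈ Ideal.jacobson (⊥ : Ideal A) := by
    rw [Ideal.jacobson, Ideal.mem_sInf]
    rintro m ⟨-, hm⟩
    let _ : Field (A ⧸ m) := Ideal.Quotient.field m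
    have : Module.Finite k (A ⧸ m) := finite_of_finite_type_of_isJacobsonRing k (A ⧸ m)
    let e : k ≃ₐ[k] (A ⧸ m) := AlgEquiv.ofBijective (Algebra.ofId k (A ⧸ m))
      (IsAlgClosed.algebraMap_bijective_of_isIntegral)
    let φ : A →ₐ[k] k := e.symm.toAlgHom.comp (Ideal.Quotient.mkₐ k m)
    have h0 : (Algebra.TensorProduct.lid k B) (Algebra.TensorProduct.map φ (AlgHom.id k B) z) = 0 :=
      IsReduced.eq_zero _ ((hz.map (Algebra.TensorProduct.map φ (AlgHom.id k B))).map
        (Algebra.TensorProduct.lid k B))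
    have h1 := key φ z i
    rw [h0] at h1
    have h2 : e.symm (Ideal.Quotient.mk m c) = 0 := by
      refine Eq.trans ?_ (h1.symm.trans ?_) <;> simp [φ, hc]
    have h3 : Ideal.Quotient.mk m c = 0 := e.symm.injective (h2.trans (map_zero e.symm).symm)
    exact Ideal.Quotient.eq_zero_iff_mem.mp h3
  have hrad : (⊥ : Ideal A).IsRadical := fun x ⟨n, hx⟩ ↦ by simpa using eq_zero_of_pow_eq_zero hx
  rwa [IsJacobsonRing.out' _ hrad, Ideal.mem_bot] at hmem

theorem isReduced_pullback_aux {k : Type u} [Field k] [IsAlgClosed k] {X Y : Scheme.{u}}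
    (f : X ⟶ Spec (.of k)) (g : Y ⟶ Spec (.of k)) [LocallyOfFiniteType f]
    [AlgebraicGeometry.IsReduced X] [AlgebraicGeometry.IsReduced Y] :
    AlgebraicGeometry.IsReduced (pullback f g) := by
  have H (A B : CommRingCat.{u}) (f' : Spec A ⟶ Spec (.of k)) (g' : Spec B ⟶ Spec (.of k))
      (_ : LocallyOfFiniteType f') (_ : AlgebraicGeometry.IsReduced (Spec A))
      (_ : AlgebraicGeometry.IsReduced (Spec B)) :
      AlgebraicGeometry.IsReduced (pullback f' g') := by
    obtain ⟨φ, rfl⟩ := Spec.map_surjective f'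
    obtain ⟨ψ, rfl⟩ := Spec.map_surjective g'
    algebraize [φ.hom, ψ.hom]
    have hφ : φ.hom.FiniteType := (HasRingHomProperty.Spec_iff (P := @LocallyOfFiniteType)).mp ‹_›
    have : Algebra.FiniteType k A := hφ
    have : _root_.IsReduced A := (affine_isReduced_iff A).mp ‹_›
    have : _root_.IsReduced B := (affine_isReduced_iff B).mp ‹_›
    have := isReduced_tensor_aux k A B
    have : AlgebraicGeometry.IsReduced (Spec (.of (A ⊗[k] B))) := (affine_isReduced_iff _).mpr this
    exact isReduced_of_isOpenImmersion (pullbackSpecIso k A B).hom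
  have hf (i) : LocallyOfFiniteType (X.affineCover.f i ≫ f) := inferInstance
  have hX (i) : AlgebraicGeometry.IsReduced (X.affineCover.X i) :=
    isReduced_of_isOpenImmersion (X.affineCover.f i)
  have hY (j) : AlgebraicGeometry.IsReduced (Y.affineCover.X j) :=
    isReduced_of_isOpenImmersion (Y.affineCover.f j)
  exact @IsReduced.of_openCover _
    (Scheme.Pullback.openCoverOfLeftRight X.affineCover Y.affineCover f g)
    fun p ↦ H _ _ _ _ (hf p.1) (hX p.1) (hY p.2)

/-- A variety over the field `k` (used for `k` algebraically closed): a reduced, separated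
`k`-scheme of finite type. It may be reducible, disconnected or empty. -/
class IsVariety {k : Type u} [Field k] (X : Over (Spec (.of k))) : Prop where
  isReduced : AlgebraicGeometry.IsReduced X.left
  isSeparated : IsSeparated X.hom
  locallyOfFiniteType : LocallyOfFiniteType X.hom
  quasiCompact : QuasiCompact X.hom

attribute [instance] IsVariety.isReduced IsVariety.isSeparated IsVariety.locallyOfFiniteType
  IsVariety.quasiCompact

theorem IsVariety.of_isOpenImmersion {k : Type u} [Field k] {U X : Over (Spec (.of k))}
    (j : U ⟶ X) [IsOpenImmersion j.left] [IsVariety X] : IsVariety U := by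
  have hw : U.hom = j.left ≫ X.hom := (Over.w j).symm
  have : IsLocallyNoetherian X.left := LocallyOfFiniteType.isLocallyNoetherian X.hom
  refine ⟨isReduced_of_isOpenImmersion j.left, ?_, ?_, ?_⟩ <;> rw [hw] <;> infer_instance

theorem IsVariety.of_iso {k : Type u} [Field k] {U X : Over (Spec (.of k))}
    (e : U ≅ X) [IsVariety X] : IsVariety U := by
  have : IsIso e.hom.left := inferInstanceAs (IsIso ((Over.forget _).map e.hom))
  exact .of_isOpenImmersion e.hom

instance isVariety_point {k : Type u} [Field k] : IsVariety (Over.mk (𝟙 (Spec (.of k)))) := by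
  refine ⟨?_, ?_, ?_, ?_⟩ <;> dsimp <;> infer_instance

instance isVariety_prod {k : Type u} [Field k] [IsAlgClosed k] (X Y : Over (Spec (.of k)))
    [IsVariety X] [IsVariety Y] : IsVariety (X ⨯ Y) := by
  have e : X ⨯ Y ≅ Over.mk (pullback.fst X.hom Y.hom ≫ X.hom) :=
    Over.isoMk (Over.prodLeftIsoPullback X Y) (by simp)
  have : IsVariety (Over.mk (pullback.fst X.hom Y.hom ≫ X.hom)) :=
    ⟨isReduced_pullback_aux X.hom Y.hom, by dsimp; infer_instance, by dsimp; infer_instance,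
      by dsimp; infer_instance⟩
  exact .of_iso e

/-- The `n`-fold product `X ^ n` over `k`. -/
noncomputable abbrev power {k : Type u} [Field k] (X : Over (Spec (.of k))) (n : ℕ) :
    Over (Spec (.of k)) :=
  ∏ᶜ fun _ : Fin n ↦ X

instance isVariety_power {k : Type u} [Field k] [IsAlgClosed k] (X : Over (Spec (.of k))) [IsVariety X] (n : ℕ) :
    IsVariety (power X n) := by
  unfold power
  induction n with
  | zero => 
    have e : (∏ᶜ fun _ : Fin 0 ↦ X) ≅ Over.mk (𝟙 (Spec (.of k))) :=
      IsTerminal.uniqueUpToIso (.ofUniqueHom (fun _ ↦ Pi.lift fun i ↦ i.elim0)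
        fun _ _ ↦ Pi.hom_ext _ _ fun i ↦ i.elim0) Over.mkIdTerminal
    exact .of_iso e
  | succ n ih =>
    have e : (∏ᶜ fun _ : Fin (n + 1) ↦ X) ≅ X ⨯ (∏ᶜ fun _ : Fin n ↦ X) :=
      (limit.isLimit _).conePointUniqueUpToIso
        (extendFanIsLimit (fun _ : Fin (n + 1) ↦ X) (limit.isLimit _) (limit.isLimit _))
    exact .of_iso e

section GrothendieckRing

variable (k : Type u) [Field k] [IsAlgClosed k]

/-- The varieties over `k`. -/
def Variety : Type (u + 1) := {X : Over (Spec (.of k)) // IsVariety X}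

variable {k} in
/-- A variety, as a generator of the Grothendieck ring. -/
noncomputable def gen (X : Over (Spec (.of k))) [h : IsVariety X] : FreeCommRing (Variety k) :=
  FreeCommRing.of ⟨X, h⟩

/-- The relations defining the Grothendieck ring of varieties: isomorphic varieties have the
same class, `[X] = [Z] + [X ∖ Z]` for `Z` closed in `X` (with open complement `U`),
`[X] * [Y] = [X × Y]`, and the class of the point `Spec k` is `1`. -/
inductive K0Rel : FreeCommRing (Variety k) → FreeCommRing (Variety k) → Prop
  | iso (X Y : Over (Spec (.of k))) [IsVariety X] [IsVariety Y] (e : X ≅ Y) :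
      K0Rel (gen X) (gen Y)
  | scissor (X Z U : Over (Spec (.of k))) [IsVariety X] [IsVariety Z] [IsVariety U]
      (i : Z ⟶ X) (j : U ⟶ X) (hi : IsClosedImmersion i.left) (hj : IsOpenImmersion j.left)
      (h : Set.range j.left = (Set.range i.left)ᶜ) :
      K0Rel (gen X) (gen Z + gen U)
  | mul (X Y : Over (Spec (.of k))) [IsVariety X] [IsVariety Y] :
      K0Rel (gen X * gen Y) (gen (X ⨯ Y))
  | one : K0Rel (gen (Over.mk (𝟙 (Spec (.of k))))) 1

/-- The Grothendieck ring of varieties over `k`: the commutative ring generated by the varieties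
over `k`, subject to the relations `K0Rel`. -/
abbrev K0 : Type (u + 1) := FreeCommRing (Variety k) ⧸ Ideal.ofRel (K0Rel k)

variable {k} in
/-- The class `[X]` (the motive) of a variety `X` in the Grothendieck ring. -/
noncomputable def motive (X : Over (Spec (.of k))) [IsVariety X] : K0 k :=
  Ideal.Quotient.mk _ (gen X)

end GrothendieckRing

section Arrangement

variable {k : Type u} [Field k] {G : Type*} [Group G] {X : Over (Spec (.of k))}

/-- The automorphism `x ↦ g • x` of `X` given by an action of `G` on `X` (multiplication in `Aut X`
is composition of functions, so that a homomorphism `G →* Aut X` is a left action). -/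
noncomputable def act (ρ : G →* Aut X) (g : G) : X ⟶ X :=
  (ρ g).hom

/-- The singular set `Sing_G(X) = ⋃_{g ≠ e} X^g` of an action of `G` on `X` by automorphisms
over `k`: the set of points of `X` fixed by a nontrivial element of `G`. Points of the variety
are the closed points of the scheme (for `k` algebraically closed, these are the `k`-points). -/
def singularSet (ρ : G →* Aut X) : Set X.left :=
  ⋃ (g : G) (_ : g ≠ 1), {x | IsClosed {x} ∧ (act ρ g).left x = x}

/-- `H_{ij}(g) = {(x₁, …, xₙ) ∈ X ^ n | g • x_i = x_j}`, the locus in `X ^ n` where the morphisms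
`g ∘ pr_i` and `pr_j` agree. -/
def diagLocus (ρ : G →* Aut X) (n : ℕ) (i j : Fin n) (g : G) : Set (power X n).left :=
  Set.range (equalizer.ι (Pi.π (fun _ : Fin n ↦ X) i ≫ act ρ g)
    (Pi.π (fun _ : Fin n ↦ X) j)).left

/-- `H_i^s = {(x₁, …, xₙ) ∈ X ^ n | x_i = s}`. -/
def pointLocus (n : ℕ) (i : Fin n) (s : X.left) : Set (power X n).left :=
  (Pi.π (fun _ : Fin n ↦ X) i).left ⁻¹' {s}

/-- The underlying set of the complement of the arrangement of all `H_{ij}(g)`, `i < j`, `g ∈ G`,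
and all `H_i^s`, `s ∈ Sing_G(X)`, in `X ^ n`. -/
def arrangementCompl (ρ : G →* Aut X) (n : ℕ) : Set (power X n).left :=
  ((⋃ (i : Fin n) (j : Fin n) (_ : i < j) (g : G), diagLocus ρ n i j g) ∪
    ⋃ (i : Fin n) (s ∈ singularSet ρ), pointLocus n i s)ᶜ

theorem isOpen_arrangementCompl [Finite G] [IsVariety X] (ρ : G →* Aut X)
    (hS : (singularSet ρ).Finite) (n : ℕ) : IsOpen (arrangementCompl ρ n) := by
  refine (IsClosed.union ?_ ?_).isOpen_compl
  · refine isClosed_iUnion_of_finite fun i ↦ isClosed_iUnion_of_finite fun j ↦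
      isClosed_iUnion_of_finite fun _ ↦ isClosed_iUnion_of_finite fun g ↦ ?_
    exact (equalizer.ι (Pi.π (fun _ : Fin n ↦ X) i ≫ act ρ g)
      (Pi.π (fun _ : Fin n ↦ X) j)).left.isClosedEmbedding.isClosed_range
  · refine isClosed_iUnion_of_finite fun i ↦ hS.isClosed_biUnion fun s hs ↦ ?_
    simp only [singularSet, Set.mem_iUnion] at hs
    obtain ⟨_, _, hs, _⟩ := hs
    exact hs.preimage (Pi.π (fun _ : Fin n ↦ X) i).left.continuous

/-- The complement of the arrangement, as an open subset of the scheme `X ^ n`. -/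
def arrangementComplOpens [Finite G] [IsVariety X] (ρ : G →* Aut X)
    (hS : (singularSet ρ).Finite) (n : ℕ) : (power X n).left.Opens :=
  ⟨arrangementCompl ρ n, isOpen_arrangementCompl ρ hS n⟩

/-- The orbit configuration space `Conf_n^G(X ∖ S)`, `S = Sing_G(X)` finite: the open subvariety of
`X ^ n` of the tuples `(x₁, …, xₙ)` of points of `X ∖ S` with `G x_i ∩ G x_j = ∅` for `i ≠ j`,
i.e. the complement of the arrangement of the `H_{ij}(g)` and the `H_i^s`. -/
noncomputable def orbitConf [Finite G] [IsVariety X] (ρ : G →* Aut X)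
    (hS : (singularSet ρ).Finite) (n : ℕ) : Over (Spec (.of k)) :=
  Over.mk ((arrangementComplOpens ρ hS n).ι ≫ (power X n).hom)

instance isVariety_orbitConf [IsAlgClosed k] [Finite G] [IsVariety X] (ρ : G →* Aut X)
    (hS : (singularSet ρ).Finite) (n : ℕ) : IsVariety (orbitConf ρ hS n) := by
  let j : orbitConf ρ hS n ⟶ power X n := Over.homMk (arrangementComplOpens ρ hS n).ι
  have : IsOpenImmersion j.left := inferInstanceAs (IsOpenImmersion (Scheme.Opens.ι _))
  exact .of_isOpenImmersion j

end Arrangement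

end OrbitConf

/-! Induction on `n`, adding one coordinate at a time. `Conf_(n+1)` is open in `X ⨯ Conf_n`, and its
complement is the union of the graphs of `|S| + |G| n` morphisms `Conf_n ⟶ X`: the constants `s ∈ S`
and the translates `g • x_i` (`range_confSuccι`). Each graph is a section of the projection to
`Conf_n`, hence closed and isomorphic to `Conf_n`. The graphs are pairwise disjoint
(`comp_removedMap_injective`): `S` is `G`-stable and misses every `x_i`, distinct coordinates lie in
distinct orbits, and `G` acts freely off `S`. Cutting the graphs out by scissor relations
(`motive_eq_card_mul_add`) gives `[X][Conf_n] = (|S| + |G| n)[Conf_n] + [Conf_(n+1)]`, so no local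
triviality of `Conf_(n+1) ⟶ Conf_n` is needed. The conditions on tuples are checked on `k`-points
only. This is enough because schemes locally of finite type over `k` are Jacobson and their closed
points are `k`-points. -/

namespace OrbitConf

/-! ### Open immersions over a base -/

section OpenImmersion

variable {S : Scheme.{u}} {U X Y : Over S}

/-- The factorization of a morphism of `S`-schemes through an open immersion containing its
range. -/
noncomputable def liftOpen (j : U ⟶ X) [IsOpenImmersion j.left] (f : Y ⟶ X)
    (h : Set.range f.left ⊆ Set.range j.left) : Y ⟶ U :=
  Over.homMk (IsOpenImmersion.lift j.left f.left h) (by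
    rw [← Over.w j, ← Category.assoc, IsOpenImmersion.lift_fac, Over.w f])

@[simp]
theorem liftOpen_comp (j : U ⟶ X) [IsOpenImmersion j.left] (f : Y ⟶ X)
    (h : Set.range f.left ⊆ Set.range j.left) : liftOpen j f h ≫ j = f := by
  ext1
  exact IsOpenImmersion.lift_fac _ _ _

theorem range_liftOpen (j : U ⟶ X) [IsOpenImmersion j.left] (f : Y ⟶ X)
    (h : Set.range f.left ⊆ Set.range j.left) :
    Set.range (liftOpen j f h).left = j.left ⁻¹' Set.range f.left := by
  have H (y) : j.left ((liftOpen j f h).left y) = f.left y := by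
    rw [← Scheme.Hom.comp_apply, ← Over.comp_left, liftOpen_comp]
  ext x
  constructor
  · rintro ⟨y, rfl⟩
    exact ⟨y, (H y).symm⟩
  · rintro ⟨y, hy⟩
    exact ⟨y, j.left.isOpenEmbedding.injective ((H y).trans hy)⟩

instance isOpenImmersion_liftOpen (j : U ⟶ X) [IsOpenImmersion j.left] (f : Y ⟶ X)
    [IsOpenImmersion f.left] (h : Set.range f.left ⊆ Set.range j.left) :
    IsOpenImmersion (liftOpen j f h).left :=
  inferInstanceAs (IsOpenImmersion (IsOpenImmersion.lift _ _ _))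

/-- The product in `Over S` is only isomorphic to the fibre product; after transport the map is a
`pullback.map` of open immersions. -/
instance isOpenImmersion_prodMap_id (j : U ⟶ X) [IsOpenImmersion j.left] :
    IsOpenImmersion (prod.map (𝟙 Y) j).left := by
  have h : (prod.map (𝟙 Y) j).left = (Over.prodLeftIsoPullback Y U).hom ≫
      pullback.map Y.hom U.hom Y.hom X.hom (𝟙 _) j.left (𝟙 _) (by simp) (by simp) ≫
      (Over.prodLeftIsoPullback Y X).inv := by
    rw [← Category.assoc, Iso.eq_comp_inv]
    ext1
    · simp [← Over.comp_left, pullback.lift_fst, pullback.map]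
    · simp only [Category.assoc, Over.prodLeftIsoPullback_hom_snd, pullback.map,
        pullback.lift_snd, Over.prodLeftIsoPullback_hom_snd_assoc]
      rw [← Over.comp_left, prod.map_snd, Over.comp_left]
  rw [h]
  infer_instance

/-- An open subset of an `S`-scheme, as an `S`-scheme. -/
noncomputable abbrev openSub (X : Over S) (V : X.left.Opens) : Over S :=
  Over.mk (V.ι ≫ X.hom)

/-- The inclusion of an open subscheme. -/
noncomputable def openSubι (X : Over S) (V : X.left.Opens) : openSub X V ⟶ X :=
  Over.homMk V.ι

instance (X : Over S) (V : X.left.Opens) : IsOpenImmersion (openSubι X V).left :=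
  inferInstanceAs (IsOpenImmersion V.ι)

theorem range_openSubι (X : Over S) (V : X.left.Opens) :
    Set.range (openSubι X V).left = (V : Set X.left) :=
  Scheme.Opens.range_ι V

end OpenImmersion

/-! ### Scissor relations and removal of disjoint sections -/

section Motive

variable {k : Type u} [Field k] [IsAlgClosed k]

theorem motive_eq_of_rel {a b : FreeCommRing (Variety k)} (h : K0Rel k a b) :
    Ideal.Quotient.mk (Ideal.ofRel (K0Rel k)) a = Ideal.Quotient.mk _ b :=
  Ideal.Quotient.eq.mpr (Submodule.subset_span ⟨a, b, h, sub_add_cancel a b⟩)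

theorem motive_congr {X Y : Over (Spec (.of k))} [IsVariety X] [IsVariety Y] (e : X ≅ Y) :
    motive X = motive Y :=
  motive_eq_of_rel (.iso X Y e)

theorem motive_scissor {X Z U : Over (Spec (.of k))} [IsVariety X] [IsVariety Z] [IsVariety U]
    (i : Z ⟶ X) (j : U ⟶ X) [hi : IsClosedImmersion i.left] [hj : IsOpenImmersion j.left]
    (h : Set.range j.left = (Set.range i.left)ᶜ) : motive X = motive Z + motive U :=
  (motive_eq_of_rel (.scissor X Z U i j hi hj h)).trans (map_add _ _ _)

theorem motive_prod (X Y : Over (Spec (.of k))) [IsVariety X] [IsVariety Y] :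
    motive (X ⨯ Y) = motive X * motive Y :=
  (motive_eq_of_rel (.mul X Y)).symm.trans (map_mul _ _ _)

theorem motive_point : motive (Over.mk (𝟙 (Spec (.of k)))) = 1 :=
  (motive_eq_of_rel .one).trans (map_one _)

/-- A surjective open immersion is an isomorphism. -/
theorem motive_eq_of_isOpenImmersion_of_range_eq {X U : Over (Spec (.of k))} [IsVariety X]
    [IsVariety U] (j : U ⟶ X) [IsOpenImmersion j.left] (h : Set.range j.left = Set.univ) :
    motive U = motive X := by
  have : Epi j.left.base := by
    rw [TopCat.epi_iff_surjective]
    exact Set.range_eq_univ.mp h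
  have : IsIso ((Over.forget _).map j) := IsOpenImmersion.isIso j.left
  have : IsIso j := isIso_of_reflects_iso j (Over.forget _)
  exact motive_congr (asIso j)

-- A section of a separated morphism is a closed immersion, and `q` is separated because `T` is
-- separated over `k`.
omit [IsAlgClosed k] in
theorem isClosedImmersion_of_comp_eq_id {T B : Over (Spec (.of k))} [IsVariety T] [IsVariety B]
    (s : B ⟶ T) (q : T ⟶ B) (h : s ≫ q = 𝟙 B) : IsClosedImmersion s.left := by
  have : IsSeparated (q.left ≫ B.hom) := by
    rw [Over.w q]
    infer_instance
  have : IsSeparated q.left := .of_comp q.left B.hom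
  have : IsClosedImmersion (s.left ≫ q.left) := by
    rw [← Over.comp_left, h]
    dsimp
    infer_instance
  exact .of_comp s.left q.left

/-- The sections are removed one at a time, each removal costing one `[B]`. The open part `U` varies
in the induction. -/
theorem motive_eq_card_mul_add_of_finset {T B : Over (Spec (.of k))} [IsVariety T] [IsVariety B]
    {A : Type*} (q : T ⟶ B) (s : A → (B ⟶ T)) (hs : ∀ a, s a ≫ q = 𝟙 B)
    (hdisj : Pairwise fun a b ↦ Disjoint (Set.range (s a).left) (Set.range (s b).left))
    (F : Finset A) (U : Over (Spec (.of k))) [IsVariety U] (j : U ⟶ T) [IsOpenImmersion j.left]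
    (h : Set.range j.left = (⋃ a ∈ F, Set.range (s a).left)ᶜ) :
    motive T = F.card * motive B + motive U := by
  classical
  induction F using Finset.induction_on generalizing U with
  | empty => simpa using (motive_eq_of_isOpenImmersion_of_range_eq j (by simpa using h)).symm
  | insert a F ha ih =>
    have hcl (b) : IsClosedImmersion (s b).left := isClosedImmersion_of_comp_eq_id _ q (hs b)
    -- `V` is what remains after removing the sections in `F`. By disjointness the section `s a`
    -- lands in `V`, where it is closed with complement `U`.
    let V : T.left.Opens := ⟨(⋃ b ∈ F, Set.range (s b).left)ᶜ,
      (F.finite_toSet.isClosed_biUnion fun b _ ↦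
        (s b).left.isClosedEmbedding.isClosed_range).isOpen_compl⟩
    have hV : IsVariety (openSub T V) := .of_isOpenImmersion (openSubι T V)
    have hrV : Set.range (openSubι T V).left = (⋃ b ∈ F, Set.range (s b).left)ᶜ :=
      range_openSubι T V
    have hsa : Set.range (s a).left ⊆ Set.range (openSubι T V).left := by
      rw [hrV, Set.subset_compl_iff_disjoint_right, Set.disjoint_iUnion₂_right]
      exact fun b hb ↦ hdisj (ne_of_mem_of_not_mem hb ha).symm
    have hj : Set.range j.left ⊆ Set.range (openSubι T V).left := by
      rw [hrV, h, Set.compl_subset_compl]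
      exact Set.biUnion_subset_biUnion_left fun b hb ↦ Finset.mem_insert_of_mem hb
    have : IsClosedImmersion (liftOpen (openSubι T V) (s a) hsa).left :=
      isClosedImmersion_of_comp_eq_id _ (openSubι T V ≫ q) (by
        rw [← Category.assoc, liftOpen_comp, hs])
    have hr : Set.range (liftOpen (openSubι T V) j hj).left =
        (Set.range (liftOpen (openSubι T V) (s a) hsa).left)ᶜ := by
      rw [range_liftOpen, range_liftOpen, h, ← Set.preimage_compl]
      ext x
      have hx : (openSubι T V).left x ∈ (⋃ b ∈ F, Set.range (s b).left)ᶜ := hrV ▸ ⟨x, rfl⟩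
      simp only [Set.mem_preimage, Finset.set_biUnion_insert, Set.compl_union, Set.mem_inter_iff,
        hx, and_true]
    rw [ih (openSub T V) (openSubι T V) hrV,
      motive_scissor (liftOpen (openSubι T V) (s a) hsa) (liftOpen (openSubι T V) j hj) hr,
      Finset.card_insert_of_notMem ha]
    push_cast
    ring

/-- If `U` is open in `T` with complement a disjoint union of images of sections of `q : T ⟶ B`,
then `[T]` is the number of sections times `[B]`, plus `[U]`. -/
theorem motive_eq_card_mul_add {T B U : Over (Spec (.of k))} [IsVariety T] [IsVariety B]
    [IsVariety U] {A : Type*} [Finite A] (q : T ⟶ B) (s : A → (B ⟶ T))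
    (hs : ∀ a, s a ≫ q = 𝟙 B)
    (hdisj : Pairwise fun a b ↦ Disjoint (Set.range (s a).left) (Set.range (s b).left))
    (j : U ⟶ T) [IsOpenImmersion j.left]
    (h : Set.range j.left = (⋃ a, Set.range (s a).left)ᶜ) :
    motive T = Nat.card A * motive B + motive U := by
  cases nonempty_fintype A
  rw [Nat.card_eq_fintype_card]
  exact motive_eq_card_mul_add_of_finset q s hs hdisj Finset.univ U j (by simpa using h)

end Motive

/-! ### `k`-points detect open and closed conditions -/

section KPoint

variable {k : Type u} [Field k] {X Y Z : Over (Spec (.of k))}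

/-- The `k`-points of a `k`-scheme. -/
abbrev KPoint (X : Over (Spec (.of k))) := Over.mk (𝟙 (Spec (.of k))) ⟶ X

/-- The point of the underlying space given by a `k`-point. -/
noncomputable def KPoint.pt (x : KPoint X) : X.left :=
  x.left (IsLocalRing.closedPoint k)

theorem KPoint.pt_comp (x : KPoint X) (f : X ⟶ Y) : KPoint.pt (x ≫ f) = f.left x.pt := by
  rfl

theorem KPoint.range_left (x : KPoint X) : Set.range x.left = {x.pt} := by
  have : Subsingleton (Spec (.of k)) := inferInstanceAs (Subsingleton (PrimeSpectrum k))
  refine Set.eq_singleton_iff_unique_mem.mpr ⟨⟨_, rfl⟩, ?_⟩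
  rintro _ ⟨y, rfl⟩
  exact congrArg x.left (Subsingleton.elim (α := Spec (.of k)) y _)

theorem KPoint.pt_mem_range_iff_of_isOpenImmersion (j : Y ⟶ X) [IsOpenImmersion j.left]
    (x : KPoint X) : x.pt ∈ Set.range j.left ↔ ∃ y : KPoint Y, y ≫ j = x := by
  constructor
  · intro h
    exact ⟨liftOpen j x (by simpa [x.range_left] using h), liftOpen_comp ..⟩
  · rintro ⟨y, rfl⟩
    exact ⟨y.pt, (y.pt_comp j).symm⟩

variable [IsAlgClosed k]

theorem KPoint.pt_injective [LocallyOfFiniteType X.hom] :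
    Function.Injective (KPoint.pt : KPoint X → X.left) := by
  intro x y h
  ext1
  exact ext_of_apply_closedPoint_eq X.hom (Over.w x) (Over.w y) h

theorem KPoint.exists_pt_eq [LocallyOfFiniteType X.hom] {x : X.left} (hx : IsClosed {x}) :
    ∃ p : KPoint X, p.pt = x :=
  ⟨Over.homMk (pointOfClosedPoint X.hom x hx) (pointOfClosedPoint_comp X.hom x hx),
    pointOfClosedPoint_apply X.hom x hx _⟩

theorem KPoint.isClosed_pt [LocallyOfFiniteType X.hom] (x : KPoint X) : IsClosed {x.pt} :=
  (pointEquivClosedPoint X.hom ⟨x.left, Over.w x⟩).2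

theorem KPoint.exists_pt_mem [LocallyOfFiniteType X.hom] {V : Set X.left} (hV : IsLocallyClosed V)
    (hne : V.Nonempty) : ∃ p : KPoint X, p.pt ∈ V := by
  have : JacobsonSpace (Spec (.of k)) := inferInstance
  have : JacobsonSpace X.left := LocallyOfFiniteType.jacobsonSpace X.hom
  obtain ⟨x, hx, hc⟩ := nonempty_inter_closedPoints hne hV
  obtain ⟨p, rfl⟩ := exists_pt_eq hc
  exact ⟨p, hx⟩

/-- Otherwise `V \ W` is a nonempty locally closed set, and so contains a `k`-point by the Jacobson
property. -/
theorem KPoint.subset_of_forall_pt [LocallyOfFiniteType X.hom] {V W : Set X.left}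
    (hV : IsOpen V) (hW : IsOpen W ∨ IsClosed W) (h : ∀ p : KPoint X, p.pt ∈ V → p.pt ∈ W) :
    V ⊆ W := by
  rw [← Set.sdiff_eq_empty, ← Set.not_nonempty_iff_eq_empty]
  intro hne
  have hlc : IsLocallyClosed (V \ W) := by
    rw [Set.sdiff_eq]
    rcases hW with hW | hW
    · exact hV.isLocallyClosed.inter hW.isClosed_compl.isLocallyClosed
    · exact hV.isLocallyClosed.inter hW.isOpen_compl.isLocallyClosed
  obtain ⟨p, hp, hp'⟩ := exists_pt_mem hlc hne
  exact hp' (h p hp)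

theorem KPoint.pt_mem_range_iff_of_isClosedImmersion [LocallyOfFiniteType X.hom] (i : Z ⟶ X)
    [IsClosedImmersion i.left] (x : KPoint X) :
    x.pt ∈ Set.range i.left ↔ ∃ z : KPoint Z, z ≫ i = x := by
  constructor
  · rintro ⟨z, hz⟩
    have : LocallyOfFiniteType Z.hom := by
      rw [← Over.w i]
      infer_instance
    -- By injectivity of `i`, `z` is the whole fibre over a closed point; being closed, it comes
    -- from a `k`-point of `Z`.
    have hc : IsClosed {z} := by
      rw [show {z} = i.left ⁻¹' {x.pt} by
        rw [← hz]
        ext y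
        exact i.left.isClosedEmbedding.injective.eq_iff.symm]
      exact x.isClosed_pt.preimage i.left.continuous
    obtain ⟨p, rfl⟩ := exists_pt_eq hc
    exact ⟨p, pt_injective ((p.pt_comp i).trans hz)⟩
  · rintro ⟨z, rfl⟩
    exact ⟨z.pt, (z.pt_comp i).symm⟩

end KPoint

/-! ### The group action and the arrangement on `k`-points -/

section Action

variable {k : Type u} [Field k] {G : Type*} [Group G] {X : Over (Spec (.of k))} (ρ : G →* Aut X)

theorem act_one : act ρ 1 = 𝟙 X := by
  rw [act, map_one]
  rfl

theorem act_mul (g h : G) : act ρ (g * h) = act ρ h ≫ act ρ g := by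
  rw [act, map_mul]
  rfl

theorem act_comp_eq_iff {Y : Over (Spec (.of k))} (x y : Y ⟶ X) (g h : G) :
    x ≫ act ρ g = y ≫ act ρ h ↔ x ≫ act ρ (h⁻¹ * g) = y := by
  rw [act_mul]
  constructor
  · intro e
    rw [← Category.assoc, e, Category.assoc, ← act_mul, inv_mul_cancel, act_one, Category.comp_id]
  · rintro rfl
    rw [Category.assoc, Category.assoc, ← act_mul, mul_inv_cancel, act_one, Category.comp_id]

variable [IsAlgClosed k]

theorem pt_mem_singularSet [LocallyOfFiniteType X.hom] (x : KPoint X) :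
    x.pt ∈ singularSet ρ ↔ ∃ g : G, g ≠ 1 ∧ x ≫ act ρ g = x := by
  simp only [singularSet, Set.mem_iUnion, Set.mem_ofPred_eq, exists_prop, x.isClosed_pt, true_and,
    ← x.pt_comp, KPoint.pt_injective.eq_iff]

/-- The stabilizers of `x` and `g • x` are conjugate, so they are trivial together. -/
theorem pt_comp_act_mem_singularSet [LocallyOfFiniteType X.hom] (x : KPoint X) (g : G) :
    KPoint.pt (x ≫ act ρ g) ∈ singularSet ρ ↔ x.pt ∈ singularSet ρ := by
  simp only [pt_mem_singularSet]
  constructor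
  · rintro ⟨h, hh, e⟩
    refine ⟨g⁻¹ * (h * g), ?_, ?_⟩
    · simpa [inv_mul_eq_one, eq_comm] using hh
    · rwa [← act_comp_eq_iff, act_mul, ← Category.assoc]
  · rintro ⟨h, hh, e⟩
    refine ⟨g * h * g⁻¹, by simpa using hh, ?_⟩
    rw [Category.assoc, ← act_mul, inv_mul_cancel_right, act_mul, ← Category.assoc, e]

theorem pt_mem_diagLocus [IsVariety X] {n : ℕ} (i j : Fin n) (g : G) (x : KPoint (power X n)) :
    x.pt ∈ diagLocus ρ n i j g ↔ (x ≫ Pi.π _ i) ≫ act ρ g = x ≫ Pi.π _ j := by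
  rw [diagLocus, KPoint.pt_mem_range_iff_of_isClosedImmersion]
  constructor
  · rintro ⟨y, rfl⟩
    simp only [Category.assoc]
    rw [equalizer.condition]
  · intro h
    exact ⟨equalizer.lift x (by simpa using h), equalizer.lift_ι _ _⟩

theorem pt_mem_arrangementCompl [IsVariety X] {n : ℕ} (x : KPoint (power X n)) :
    x.pt ∈ arrangementCompl ρ n ↔
      (∀ i j, i < j → ∀ g : G, (x ≫ Pi.π _ i) ≫ act ρ g ≠ x ≫ Pi.π _ j) ∧
        ∀ i, KPoint.pt (x ≫ Pi.π _ i) ∉ singularSet ρ := by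
  simp only [arrangementCompl, Set.mem_compl_iff, Set.mem_union, Set.mem_iUnion, pt_mem_diagLocus,
    not_or, not_exists, pointLocus, Set.mem_preimage, Set.mem_singleton_iff, KPoint.pt_comp]
  refine and_congr Iff.rfl (forall_congr' fun i ↦ ?_)
  exact ⟨fun h hs ↦ h _ hs rfl, fun h s hs e ↦ h (e ▸ hs)⟩

end Action

/-! ### Graphs as closed subvarieties -/

section Graph

variable {k : Type u} [Field k] {X B : Over (Spec (.of k))}

/-- The graph of `f : B ⟶ X`, as a section of `X ⨯ B ⟶ B`. -/
noncomputable abbrev graph (f : B ⟶ X) : B ⟶ X ⨯ B :=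
  prod.lift f (𝟙 B)

theorem graph_snd (f : B ⟶ X) : graph f ≫ prod.snd = 𝟙 B :=
  prod.lift_snd _ _

variable [IsAlgClosed k] [IsVariety X] [IsVariety B]

instance isClosedImmersion_graph (f : B ⟶ X) : IsClosedImmersion (graph f).left :=
  isClosedImmersion_of_comp_eq_id _ prod.snd (graph_snd f)

theorem pt_mem_range_graph (f : B ⟶ X) (p : KPoint (X ⨯ B)) :
    p.pt ∈ Set.range (graph f).left ↔ (p ≫ prod.snd) ≫ f = p ≫ prod.fst := by
  rw [KPoint.pt_mem_range_iff_of_isClosedImmersion]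
  constructor
  · rintro ⟨b, rfl⟩
    simp [prod.lift_fst, prod.lift_snd_assoc]
  · intro h
    refine ⟨p ≫ prod.snd, ?_⟩
    ext1
    · simpa [prod.lift_fst] using h
    · simp [prod.lift_snd]

/-- The intersection of the two graphs is closed, so if nonempty it contains a `k`-point, over which
`f` and `f'` agree. -/
theorem disjoint_range_graph (f f' : B ⟶ X) (h : ∀ b : KPoint B, b ≫ f ≠ b ≫ f') :
    Disjoint (Set.range (graph f).left) (Set.range (graph f').left) := by
  rw [Set.disjoint_iff_inter_eq_empty, ← Set.not_nonempty_iff_eq_empty]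
  intro hne
  obtain ⟨p, hp, hp'⟩ := KPoint.exists_pt_mem
    ((graph f).left.isClosedEmbedding.isClosed_range.inter
      (graph f').left.isClosedEmbedding.isClosed_range).isLocallyClosed hne
  rw [pt_mem_range_graph] at hp hp'
  exact h _ (hp.trans hp'.symm)

end Graph

/-! ### Splitting off the coordinate `0` of a power -/

section Power

variable {k : Type u} [Field k] (X : Over (Spec (.of k))) (n : ℕ)

/-- `X ⨯ X ^ n ≅ X ^ (n + 1)`. -/
noncomputable def powerSuccIso : X ⨯ power X n ≅ power X (n + 1) where
  hom := Pi.lift (Fin.cases prod.fst fun i ↦ prod.snd ≫ Pi.π _ i)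
  inv := prod.lift (Pi.π _ 0) (Pi.lift fun i ↦ Pi.π _ i.succ)
  hom_inv_id := by
    ext1
    · simp [prod.lift_fst]
    · refine Pi.hom_ext _ _ fun i ↦ ?_
      simp [prod.lift_snd_assoc]
  inv_hom_id := by
    refine Pi.hom_ext _ _ fun i ↦ ?_
    cases i using Fin.cases <;> simp [prod.lift_fst, prod.lift_snd_assoc]

@[simp]
theorem powerSuccIso_hom_π_zero :
    (powerSuccIso X n).hom ≫ Pi.π (fun _ : Fin (n + 1) ↦ X) 0 = prod.fst := by
  simp [powerSuccIso]

@[simp]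
theorem powerSuccIso_hom_π_succ (i : Fin n) :
    (powerSuccIso X n).hom ≫ Pi.π (fun _ : Fin (n + 1) ↦ X) i.succ = prod.snd ≫ Pi.π _ i := by
  simp [powerSuccIso]

@[simp]
theorem powerSuccIso_inv_fst : (powerSuccIso X n).inv ≫ prod.fst = Pi.π _ 0 :=
  prod.lift_fst _ _

@[simp]
theorem powerSuccIso_inv_snd_π (i : Fin n) :
    (powerSuccIso X n).inv ≫ prod.snd ≫ Pi.π _ i = Pi.π _ i.succ := by
  simp [powerSuccIso, prod.lift_snd_assoc]

end Power

/-! ### The recursion for orbit configuration spaces -/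

section Conf

variable {k : Type u} [Field k] {G : Type*} [Group G] [Finite G]
  {X : Over (Spec (.of k))} [IsVariety X] (ρ : G →* Aut X) (hS : (singularSet ρ).Finite) (n : ℕ)

/-- The inclusion of the orbit configuration space in `X ^ n`. -/
noncomputable def confι : orbitConf ρ hS n ⟶ power X n :=
  openSubι _ (arrangementComplOpens ρ hS n)

instance isOpenImmersion_confι : IsOpenImmersion (confι ρ hS n).left :=
  inferInstanceAs (IsOpenImmersion (openSubι _ (arrangementComplOpens ρ hS n)).left)

theorem range_confι : Set.range (confι ρ hS n).left = arrangementCompl ρ n :=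
  range_openSubι _ (arrangementComplOpens ρ hS n)

/-- The open immersion `X ⨯ Conf_n ⟶ X ^ (n + 1)`. -/
noncomputable def prodConfι : X ⨯ orbitConf ρ hS n ⟶ power X (n + 1) :=
  prod.map (𝟙 X) (confι ρ hS n) ≫ (powerSuccIso X n).hom

instance isOpenImmersion_prodConfι : IsOpenImmersion (prodConfι ρ hS n).left := by
  have : IsIso (powerSuccIso X n).hom.left :=
    inferInstanceAs (IsIso ((Over.forget _).map (powerSuccIso X n).hom))
  rw [prodConfι, Over.comp_left]
  infer_instance

variable {n}

theorem prodConfι_π_zero :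
    prodConfι ρ hS n ≫ Pi.π (fun _ : Fin (n + 1) ↦ X) 0 = prod.fst := by
  simp [prodConfι]

theorem prodConfι_π_succ (i : Fin n) :
    prodConfι ρ hS n ≫ Pi.π (fun _ : Fin (n + 1) ↦ X) i.succ =
      prod.snd ≫ confι ρ hS n ≫ Pi.π _ i := by
  simp [prodConfι]

variable [IsAlgClosed k]

omit [IsAlgClosed k] in
theorem pt_comp_confι_mem (b : KPoint (orbitConf ρ hS n)) :
    KPoint.pt (b ≫ confι ρ hS n) ∈ arrangementCompl ρ n := by
  rw [← range_confι ρ hS, KPoint.pt_comp]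
  exact ⟨_, rfl⟩

-- Separates the conditions on the last `n` coordinates from those on the new coordinate `0`,
-- written in the form "not in the graph of `g • x_i`".
omit [Finite G] in
theorem pt_mem_arrangementCompl_succ (x : KPoint (power X (n + 1))) :
    x.pt ∈ arrangementCompl ρ (n + 1) ↔
      KPoint.pt (x ≫ (powerSuccIso X n).inv ≫ prod.snd) ∈ arrangementCompl ρ n ∧
      KPoint.pt (x ≫ Pi.π _ 0) ∉ singularSet ρ ∧
        ∀ (i : Fin n) (g : G), (x ≫ Pi.π _ i.succ) ≫ act ρ g ≠ x ≫ Pi.π _ 0 := by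
  have e (i : Fin n) : (x ≫ (powerSuccIso X n).inv ≫ prod.snd) ≫ Pi.π (fun _ : Fin n ↦ X) i =
      x ≫ Pi.π _ i.succ := by
    simp
  -- The arrangement asks `g • x_0 ≠ x_i` since `0 < i.succ`; replacing `g` by `g⁻¹` reverses the
  -- direction.
  have e' (i : Fin n) : (∀ g : G, (x ≫ Pi.π _ i.succ) ≫ act ρ g ≠ x ≫ Pi.π _ 0) ↔
      ∀ g : G, (x ≫ Pi.π _ 0) ≫ act ρ g ≠ x ≫ Pi.π _ i.succ := by
    rw [← (Equiv.inv G).forall_congr_right]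
    refine forall_congr' fun g ↦ not_congr ?_
    have := act_comp_eq_iff ρ (x ≫ Pi.π _ 0) (x ≫ Pi.π _ i.succ) g 1
    simp only [act_one, Category.comp_id, inv_one, one_mul] at this
    have h2 := act_comp_eq_iff ρ (x ≫ Pi.π _ i.succ) (x ≫ Pi.π _ 0) 1 g
    simp only [act_one, Category.comp_id, mul_one] at h2
    rw [Equiv.inv_apply, ← h2, eq_comm]
  rw [pt_mem_arrangementCompl, pt_mem_arrangementCompl]
  simp only [e, e', Fin.forall_fin_succ, Fin.succ_lt_succ_iff, Fin.succ_pos, forall_const,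
    not_lt_zero, IsEmpty.forall_iff, true_and]
  tauto

theorem pt_comp_prodConfι_mem (p : KPoint (X ⨯ orbitConf ρ hS n)) :
    KPoint.pt (p ≫ prodConfι ρ hS n) ∈ arrangementCompl ρ (n + 1) ↔
      KPoint.pt (p ≫ prod.fst) ∉ singularSet ρ ∧
        ∀ (i : Fin n) (g : G),
          (p ≫ prod.snd) ≫ (confι ρ hS n ≫ Pi.π _ i) ≫ act ρ g ≠ p ≫ prod.fst := by
  have h := pt_comp_confι_mem ρ hS (p ≫ prod.snd)
  rw [pt_mem_arrangementCompl_succ]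
  have e : prodConfι ρ hS n ≫ (powerSuccIso X n).inv ≫ prod.snd = prod.snd ≫ confι ρ hS n := by
    simp [prodConfι]
  rw [Category.assoc] at h
  simp only [Category.assoc, prodConfι_π_zero, e, h, true_and]
  simp only [← Category.assoc (prodConfι ρ hS n), prodConfι_π_succ, Category.assoc]

theorem range_confι_succ_subset :
    Set.range (confι ρ hS (n + 1)).left ⊆ Set.range (prodConfι ρ hS n).left := by
  rw [range_confι]
  refine KPoint.subset_of_forall_pt (isOpen_arrangementCompl ρ hS _)
    (.inl (prodConfι ρ hS n).left.isOpenEmbedding.isOpen_range) fun x hx ↦ ?_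
  rw [pt_mem_arrangementCompl_succ, ← range_confι ρ hS,
    KPoint.pt_mem_range_iff_of_isOpenImmersion] at hx
  obtain ⟨⟨b, hb⟩, -⟩ := hx
  rw [KPoint.pt_mem_range_iff_of_isOpenImmersion]
  refine ⟨prod.lift (x ≫ Pi.π _ 0) b, ?_⟩
  rw [prodConfι, ← Category.assoc, ← Iso.eq_comp_inv]
  ext1
  · simp [prod.lift_fst]
  · simpa [prod.lift_snd_assoc, prod.lift_snd] using hb

/-- The open immersion `Conf_(n + 1) ⟶ X ⨯ Conf_n`. -/
noncomputable def confSuccι : orbitConf ρ hS (n + 1) ⟶ X ⨯ orbitConf ρ hS n :=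
  liftOpen (prodConfι ρ hS n) (confι ρ hS (n + 1)) (range_confι_succ_subset ρ hS)

instance isOpenImmersion_confSuccι : IsOpenImmersion (confSuccι ρ hS (n := n)).left :=
  isOpenImmersion_liftOpen ..

omit [Finite G] in
theorem exists_pt_eq_of_mem_singularSet (s : singularSet ρ) : ∃ x : KPoint X, x.pt = s := by
  refine KPoint.exists_pt_eq ?_
  have := s.2
  simp only [singularSet, Set.mem_iUnion] at this
  obtain ⟨_, _, h, _⟩ := this
  exact h

/-- The morphisms from `Conf_n` to `X` whose graphs are removed from `X ⨯ Conf_n` to get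
`Conf_(n + 1)`: the constant maps to singular points, and the `G`-translates of the
coordinates. -/
noncomputable def removedMap : singularSet ρ ⊕ Fin n × G → (orbitConf ρ hS n ⟶ X)
  | .inl s => Over.mkIdTerminal.from _ ≫ (exists_pt_eq_of_mem_singularSet ρ s).choose
  | .inr (i, g) => (confι ρ hS n ≫ Pi.π _ i) ≫ act ρ g

theorem pt_comp_removedMap_inl (b : KPoint (orbitConf ρ hS n)) (s : singularSet ρ) :
    KPoint.pt (b ≫ removedMap ρ hS (.inl s)) = s := by
  -- `Spec k` is terminal, so `b` followed by the structure map is the identity of the point.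
  rw [← (exists_pt_eq_of_mem_singularSet ρ s).choose_spec, removedMap, ← Category.assoc,
    Over.mkIdTerminal.hom_ext (b ≫ _) (𝟙 _), Category.id_comp]

theorem pt_comp_removedMap_inr_notMem (b : KPoint (orbitConf ρ hS n)) (a : Fin n × G) :
    KPoint.pt (b ≫ removedMap ρ hS (.inr a)) ∉ singularSet ρ := by
  rw [removedMap, ← Category.assoc, pt_comp_act_mem_singularSet, ← Category.assoc]
  exact ((pt_mem_arrangementCompl ρ _).mp (pt_comp_confι_mem ρ hS b)).2 a.1

/-- Yields both the disjointness of the graphs and the count `|S| + n |G|`: over any configuration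
the removed values are all distinct. -/
theorem comp_removedMap_injective (b : KPoint (orbitConf ρ hS n)) :
    Function.Injective fun a ↦ b ≫ removedMap ρ hS a := by
  have hb := (pt_mem_arrangementCompl ρ _).mp (pt_comp_confι_mem ρ hS b)
  rintro (s | ⟨i, g⟩) (t | ⟨j, h⟩) e <;> replace e : b ≫ _ = b ≫ _ := e
  · rw [Subtype.ext ((pt_comp_removedMap_inl ρ hS b s).symm.trans
      ((congrArg KPoint.pt e).trans (pt_comp_removedMap_inl ρ hS b t)))]
  · refine (pt_comp_removedMap_inr_notMem ρ hS b (j, h) ?_).elim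
    rw [← e, pt_comp_removedMap_inl]
    exact s.2
  · refine (pt_comp_removedMap_inr_notMem ρ hS b (i, g) ?_).elim
    rw [e, pt_comp_removedMap_inl]
    exact t.2
  · simp only [removedMap, ← Category.assoc] at e
    rcases lt_trichotomy i j with hij | rfl | hij
    · exact (hb.1 i j hij _ ((act_comp_eq_iff ρ _ _ g h).mp e)).elim
    · by_cases hgh : g = h
      · rw [hgh]
      -- If `g • x_i = h • x_i` with `g ≠ h`, then `h⁻¹ * g` is a nontrivial stabilizer element,
      -- which puts `x_i` in `S`.
      · refine (hb.2 i ((pt_mem_singularSet ρ _).mpr ⟨h⁻¹ * g, ?_,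
          (act_comp_eq_iff ρ _ _ g h).mp e⟩)).elim
        rw [ne_eq, inv_mul_eq_one]
        exact Ne.symm hgh
    · exact (hb.1 j i hij _ ((act_comp_eq_iff ρ _ _ h g).mp e.symm)).elim

/-- Both sides are open, so it suffices that they have the same `k`-points. -/
theorem range_confSuccι : Set.range (confSuccι ρ hS (n := n)).left =
    (⋃ a, Set.range (graph (removedMap ρ hS (n := n) a)).left)ᶜ := by
  have : Finite (singularSet ρ) := hS
  have hopen : IsOpen (⋃ a, Set.range (graph (removedMap ρ hS (n := n) a)).left)ᶜ :=
    (isClosed_iUnion_of_finite fun a ↦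
      (graph (removedMap ρ hS a)).left.isClosedEmbedding.isClosed_range).isOpen_compl
  have hopen' := (confSuccι ρ hS (n := n)).left.isOpenEmbedding.isOpen_range
  have key (p : KPoint (X ⨯ orbitConf ρ hS n)) : p.pt ∈ Set.range (confSuccι ρ hS (n := n)).left ↔
      p.pt ∈ (⋃ a, Set.range (graph (removedMap ρ hS (n := n) a)).left)ᶜ := by
    rw [confSuccι, range_liftOpen, range_confι, Set.mem_preimage, ← KPoint.pt_comp,
      pt_comp_prodConfι_mem]
    simp only [Set.mem_compl_iff, Set.mem_iUnion, not_exists, pt_mem_range_graph, Sum.forall,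
      Prod.forall]
    -- Avoiding `S` is avoiding the graphs of the constants; the conditions from the translates
    -- agree by definition.
    refine and_congr ⟨fun h s e ↦ h ?_, fun h hs ↦ h ⟨_, hs⟩ ?_⟩ Iff.rfl
    · rw [← e, pt_comp_removedMap_inl]
      exact s.2
    · apply KPoint.pt_injective
      rw [pt_comp_removedMap_inl]
  exact (KPoint.subset_of_forall_pt hopen' (.inl hopen) fun p ↦ (key p).mp).antisymm
    (KPoint.subset_of_forall_pt hopen (.inl hopen') fun p ↦ (key p).mpr)

theorem motive_orbitConf_succ : motive (orbitConf ρ hS (n + 1)) =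
    motive (orbitConf ρ hS n) *
      (motive X - ((singularSet ρ).ncard : K0 k) - (Nat.card G : K0 k) * (n : K0 k)) := by
  have : Finite (singularSet ρ) := hS
  have h := motive_eq_card_mul_add (prod.snd : X ⨯ orbitConf ρ hS n ⟶ _)
    (fun a ↦ graph (removedMap ρ hS a)) (fun a ↦ graph_snd _)
    (fun a a' haa' ↦ disjoint_range_graph _ _ fun b e ↦
      haa' (comp_removedMap_injective ρ hS b e))
    (confSuccι ρ hS) (range_confSuccι ρ hS)
  rw [motive_prod, Nat.card_sum, Nat.card_prod, Nat.card_fin, Nat.card_coe_set_eq] at h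
  push_cast at h
  linear_combination -h

/-- `X ^ 0` is the point, and with no coordinates nothing is removed. -/
theorem motive_orbitConf_zero : motive (orbitConf ρ hS 0) = 1 := by
  have e : Over.mk (𝟙 (Spec (.of k))) ≅ power X 0 :=
    Over.mkIdTerminal.uniqueUpToIso
      (.ofUniqueHom (fun _ ↦ Pi.lift fun i ↦ i.elim0) fun _ _ ↦ Pi.hom_ext _ _ fun i ↦ i.elim0)
  rw [motive_eq_of_isOpenImmersion_of_range_eq (confι ρ hS 0), ← motive_congr e, motive_point]
  rw [range_confι]
  simp [arrangementCompl]

end Conf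

end OrbitConf

theorem theorem3p15 {k : Type u} [Field k] [IsAlgClosed k]
    {G : Type*} [Group G] [Finite G]
    (X : Over (Spec (.of k))) [OrbitConf.IsVariety X]
    (ρ : G →* Aut X)
    (hS : (OrbitConf.singularSet ρ).Finite)
    (hS_nonempty : (OrbitConf.singularSet ρ).Nonempty)
    (n : ℕ) :
    OrbitConf.motive (OrbitConf.orbitConf ρ hS n) =
      ∏ i ∈ Finset.range n,
        (OrbitConf.motive X - ((OrbitConf.singularSet ρ).ncard : OrbitConf.K0 k)
          - (Nat.card G : OrbitConf.K0 k) * (i : OrbitConf.K0 k)) := by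
  induction n with
  | zero => simpa using OrbitConf.motive_orbitConf_zero ρ hS
  | succ n ih => rw [OrbitConf.motive_orbitConf_succ, ih, Finset.prod_range_succ]
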